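/- Let $g:[0,\infty)\to[0,\infty)$ be a concave function with $g(t)=0$ if and only if $t=0$, and let $d(x,y)=g(|x-y|)$ be the corresponding distance on $\mathbf R$. Let $x_1<x_2<\dots<x_{2n}$ be points of the line. For indices $1\le i<j\le 2n$ of opposite parity, let $W_{i,j}$ be the minimum weight of a perfect matching in the complete graph on the $j-i+1$ points $x_i<x_{i+1}<\dots<x_j$, where the edge between $x_k$ and $x_l$ has weight $d(x_k,x_l)$ and the weight of a matching is the sum of the weights of its edges. Put moreover $W_{i,i-1}=0$ and $W_{i+2,i-1}=-d(x_i,x_{i+1})$. Then for all $i,j$ of opposite parity with $1\le i<j\le 2n$ $$W_{i,j}=\min\bigl[\,d(x_i,x_j)+W_{i+1,j-1},\ W_{i,j-2}+W_{i+2,j}-W_{i+2,j-2}\,\bigr].$$ Moreover, the bottom-up evaluation of this recursion (first the initial values $W_{i,i-1}$, $1\le i\le 2n+1$, and $W_{i+2,i-1}$, $1\le i\le 2n-1$; then, for $s=1,\dots,n$ and for $i=1,\dots,2n-2s+1$, the value $W_{i,j}$ with $j=i+2s-1$) computes all the weights $W_{i,j}$, $1\le i<j\le 2n$, $i,j$ of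 opposite parity, in $O(n^2)$ operations ($n\ge1$). Here evaluations of $d$ at a pair of points, additions, subtractions, negations and minima of real numbers, index arithmetic, table accesses and loop steps are operations of unit cost, and the constant in $O(n^2)$ is absolute: it depends neither on $g$ nor on the points. -/

import Mathlib

namespace LineMatching

/-! ### Distances on the line and minimum-weight perfect matchings -/

/-- A gauge: a nonnegative concave function `g` on `[0, ∞)` with `g t = 0` iff `t = 0`.
Values of `g` at negative arguments are irrelevant. -/
structure IsConcaveGauge (g : ℝ → ℝ) : Prop where
  concave : ConcaveOn ℝ (Set.Ici 0) g
  nonneg : ∀ t : ℝ, 0 ≤ t → 0 ≤ g t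
  eq_zero_iff : ∀ t : ℝ, 0 ≤ t → (g t = 0 ↔ t = 0)

/-- The distance `d_g(a, b) = g(|a - b|)` on the real line. -/
def gaugeDist (g : ℝ → ℝ) (a b : ℝ) : ℝ := g |a - b|

theorem gaugeDist_comm (g : ℝ → ℝ) (a b : ℝ) : gaugeDist g a b = gaugeDist g b a := by
  unfold gaugeDist
  rw [abs_sub_comm]

/-- The weight `d_g(x_a, x_b)` of the (undirected) edge between the points number `a` and `b`. -/
def edgeWeight (g : ℝ → ℝ) (x : ℕ → ℝ) : Sym2 ℕ → ℝ :=
  Sym2.lift ⟨fun a b => gaugeDist g (x a) (x b), fun a b => gaugeDist_comm g (x a) (x b)⟩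

/-- `M` is a perfect matching of the complete graph on the points number `i, i + 1, …, j`:
a set of pairwise disjoint edges that covers exactly these points. -/
def IsPerfectMatchingOn (i j : ℕ) (M : (⊤ : SimpleGraph ℕ).Subgraph) : Prop :=
  M.verts = Set.Icc i j ∧ M.IsMatching

/-- The weight of a matching: the sum of the weights of its edges. -/
noncomputable def matchingWeight (g : ℝ → ℝ) (x : ℕ → ℝ) (M : (⊤ : SimpleGraph ℕ).Subgraph) : ℝ :=
  ∑ᶠ e ∈ M.edgeSet, edgeWeight g x e

/-- The weights of all perfect matchings on the points `x_i, …, x_j`. -/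
def matchingWeights (g : ℝ → ℝ) (x : ℕ → ℝ) (i j : ℕ) : Set ℝ :=
  {w | ∃ M : (⊤ : SimpleGraph ℕ).Subgraph, IsPerfectMatchingOn i j M ∧ w = matchingWeight g x M}

/-- The numbers `W_{i,j}`.  For `i < j` of opposite parity this is the minimum weight of a perfect
matching on `x_i, …, x_j`.  The other two cases are the conventions `W_{i,i-1} = 0` and
`W_{i+2,i-1} = -d_g(x_i, x_{i+1})`. -/
noncomputable def W (g : ℝ → ℝ) (x : ℕ → ℝ) (i j : ℕ) : ℝ :=
  if i = j + 1 then 0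
  else if i = j + 3 then -gaugeDist g (x (j + 1)) (x (j + 2))
  else sInf (matchingWeights g x i j)

/-! ### A small machine model with a step count

Programs consist of loops over integer variables and of assignments to a table of real numbers.
A program is a fixed piece of syntax; its only inputs are the number `n` and the table of
distances, which it can query entry by entry.  Each node of an expression, each assignment, each
loop set-up and each loop iteration costs one operation. -/

/-- Natural-number expressions: the input size `n`, literals, loop variables, sums and
(truncated) differences. -/
inductive IndexExpr where
  | size : IndexExpr
  | lit (c : ℕ) : IndexExpr
  | var (v : ℕ) : IndexExpr
  | add (a b : IndexExpr) : IndexExpr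
  | sub (a b : IndexExpr) : IndexExpr

/-- Value of an index expression for the input size `n` and the values `env` of the variables. -/
def IndexExpr.eval (n : ℕ) (env : ℕ → ℕ) : IndexExpr → ℕ
  | .size => n
  | .lit c => c
  | .var v => env v
  | .add a b => a.eval n env + b.eval n env
  | .sub a b => a.eval n env - b.eval n env

/-- Number of operations in the evaluation of an index expression. -/
def IndexExpr.cost : IndexExpr → ℕ
  | .size => 1
  | .lit _ => 1
  | .var _ => 1
  | .add a b => a.cost + b.cost + 1
  | .sub a b => a.cost + b.cost + 1

/-- Real expressions: the constant `0`, the table entry `(a, b)`, the distance between the points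
number `a` and `b`, negatives, sums, differences and minima. -/
inductive RealExpr where
  | zero : RealExpr
  | load (a b : IndexExpr) : RealExpr
  | dist (a b : IndexExpr) : RealExpr
  | neg (p : RealExpr) : RealExpr
  | add (p q : RealExpr) : RealExpr
  | sub (p q : RealExpr) : RealExpr
  | min (p q : RealExpr) : RealExpr

/-- Value of a real expression; `D a b` is the distance between the points number `a` and `b`,
and `mem` is the current table. -/
noncomputable def RealExpr.eval (n : ℕ) (D : ℕ → ℕ → ℝ) (env : ℕ → ℕ) (mem : ℕ → ℕ → ℝ) :
    RealExpr → ℝ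
  | .zero => 0
  | .load a b => mem (a.eval n env) (b.eval n env)
  | .dist a b => D (a.eval n env) (b.eval n env)
  | .neg p => -(p.eval n D env mem)
  | .add p q => p.eval n D env mem + q.eval n D env mem
  | .sub p q => p.eval n D env mem - q.eval n D env mem
  | .min p q => Min.min (p.eval n D env mem) (q.eval n D env mem)

/-- Number of operations in the evaluation of a real expression. -/
def RealExpr.cost : RealExpr → ℕ
  | .zero => 1
  | .load a b => a.cost + b.cost + 1
  | .dist a b => a.cost + b.cost + 1
  | .neg p => p.cost + 1
  | .add p q => p.cost + q.cost + 1
  | .sub p q => p.cost + q.cost + 1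
  | .min p q => p.cost + q.cost + 1

/-- Programs: assignment of a value to the table entry `(a, b)`; sequential composition; and
the loop in which the variable `v` runs through `1, 2, …, bound`, in this order. -/
inductive Program where
  | store (a b : IndexExpr) (p : RealExpr) : Program
  | seq (P Q : Program) : Program
  | loop (v : ℕ) (bound : IndexExpr) (body : Program) : Program

/-- `upTo r f s` applies `f 1`, then `f 2`, …, then `f r` to `s`. -/
def upTo {σ : Type} (r : ℕ) (f : ℕ → σ → σ) (s : σ) : σ :=
  match r with
  | 0 => s
  | k + 1 => f (k + 1) (upTo k f s)

/-- Execution of a program: the final table and the number of operations performed. -/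
noncomputable def Program.exec (n : ℕ) (D : ℕ → ℕ → ℝ) :
    Program → (ℕ → ℕ) → (ℕ → ℕ → ℝ) → (ℕ → ℕ → ℝ) × ℕ
  | .store a b p, env, mem =>
      (fun k l => if k = a.eval n env ∧ l = b.eval n env then p.eval n D env mem else mem k l,
        a.cost + b.cost + p.cost + 1)
  | .seq P Q, env, mem =>
      ((Q.exec n D env (P.exec n D env mem).1).1,
        (P.exec n D env mem).2 + (Q.exec n D env (P.exec n D env mem).1).2)
  | .loop v bound body, env, mem =>
      upTo (bound.eval n env)
        (fun k st =>
          ((body.exec n D (Function.update env v k) st.1).1,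
            st.2 + (body.exec n D (Function.update env v k) st.1).2 + 1))
        (mem, bound.cost + 1)

/-! ### The bottom-up program -/

/-- The loop variable `i`. -/
def iVar : IndexExpr := .var 0

/-- The loop variable `s`, the number of the row of the pyramid that is being computed. -/
def sVar : IndexExpr := .var 1

/-- The expression `j = i + 2 s - 1`. -/
def jExpr : IndexExpr := .sub (.add iVar (.add sVar sVar)) (.lit 1)

/-- `for i = 1, …, 2 n + 1: W[i, i - 1] := 0`. -/
def initZero : Program :=
  .loop 0 (.add (.add .size .size) (.lit 1))
    (.store iVar (.sub iVar (.lit 1)) .zero)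

/-- `for i = 1, …, 2 n - 1: W[i + 2, i - 1] := -d(x_i, x_{i+1})`. -/
def initNeg : Program :=
  .loop 0 (.sub (.add .size .size) (.lit 1))
    (.store (.add iVar (.lit 2)) (.sub iVar (.lit 1)) (.neg (.dist iVar (.add iVar (.lit 1)))))

/-- `W[i, j] := min (d(x_i, x_j) + W[i+1, j-1]) (W[i, j-2] + W[i+2, j] - W[i+2, j-2])`. -/
def updateEntry : Program :=
  .store iVar jExpr
    (.min
      (.add (.dist iVar jExpr) (.load (.add iVar (.lit 1)) (.sub jExpr (.lit 1))))
      (.sub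
        (.add (.load iVar (.sub jExpr (.lit 2))) (.load (.add iVar (.lit 2)) jExpr))
        (.load (.add iVar (.lit 2)) (.sub jExpr (.lit 2)))))

/-- The bottom-up evaluation of the recursion: after the initial conditions, for `s = 1, …, n`
and for `i = 1, …, 2 n - 2 s + 1` the entry `(i, j)` with `j = i + 2 s - 1` is computed. -/
def bottomUp : Program :=
  .seq initZero
    (.seq initNeg
      (.loop 1 .size
        (.loop 0 (.add (.sub (.add .size .size) (.add sVar sVar)) (.lit 1))
          updateEntry)))

end LineMatching

namespace LineMatching

/-! Concavity gives a four-point inequality: replacing two crossing edges by the nested pair never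
raises the weight (`IsConcaveGauge.nestedLeCrossing`). Reinserting the edge of the first point into
an already uncrossed matching therefore costs nothing (`NoncrossingWeight.exists_insert`), and the
minimum weight is attained by noncrossing matchings. Such a matching splits at the partner of its
first point into an inner and a right-hand matching, so `V a b = W a (b - 1)`, on half-open
intervals, is a minimum over that partner (`IsBlockMinimum`).

The heart is the quadrangle inequality `V a b + V a' b' ≤ V a b' + V a' b` for nested intervals,
proved by exchanging parts of optimal matchings. With both ends moved by two it bounds `V a b` by
the second term of the recursion; the edge joining the end points gives the first bound. Conversely,
if the first point of an optimal matching is not matched to the last one, the matching splits at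
some `c` strictly inside, and quadrangle inequalities at `c` show that the second term is at most
the optimum.

The program is correct because each entry reads only shorter intervals or initial values; it fills
at most `2 * n` entries in each of `n` rows, at bounded cost per entry. -/

/-! ### The four-point inequality from concavity -/

/-- The crossing inequality on a set `s` of indices: of the two ways to match the outer and the
inner points of four ordered points across each other, the nested one is at most as expensive as
the crossing one. -/
def NestedLeCrossing (s : Set ℕ) (d : ℕ → ℕ → ℝ) : Prop :=
  ∀ a ∈ s, ∀ b ∈ s, ∀ c ∈ s, ∀ e ∈ s, a < b → b < c → c < e → d a e + d b c ≤ d a c + d b e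

/-- With consecutive gaps `u`, `v`, `w`, the crossing lengths `u + v` and `v + w` are convex
combinations of `v` and `u + v + w` with interchanged coefficients. Adding the two concavity
inequalities gives the claim. -/
theorem IsConcaveGauge.nestedLeCrossing {g : ℝ → ℝ} (hg : IsConcaveGauge g) {s : Set ℕ}
    {x : ℕ → ℝ} (hx : StrictMonoOn x s) :
    NestedLeCrossing s (fun a b => gaugeDist g (x a) (x b)) := by
  intro a ha b hb c hc e he hab hbc hce
  have h1 := hx ha hb hab
  have h2 := hx hb hc hbc
  have h3 := hx hc he hce
  simp only [gaugeDist]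
  rw [abs_sub_comm (x a) (x e), abs_sub_comm (x b) (x c), abs_sub_comm (x a) (x c),
    abs_sub_comm (x b) (x e), abs_of_pos (by linarith), abs_of_pos (by linarith),
    abs_of_pos (by linarith), abs_of_pos (by linarith)]
  set u := x b - x a
  set v := x c - x b
  set w := x e - x c
  have huw : 0 < u + w := by simp only [u, w]; linarith
  have hu : 0 < u := by simp only [u]; linarith
  have hv : 0 < v := by simp only [v]; linarith
  have hw : 0 < w := by simp only [w]; linarith
  have e1 : x e - x a = u + v + w := by simp only [u, v, w]; ring
  have e2 : x c - x a = u + v := by simp only [u, v]; ring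
  have e3 : x e - x b = v + w := by simp only [v, w]; ring
  rw [e1, e2, e3]
  have m1 : v ∈ Set.Ici (0 : ℝ) := hv.le
  have m2 : u + v + w ∈ Set.Ici (0 : ℝ) := by simp only [Set.mem_Ici]; linarith
  have hsum : u / (u + w) + w / (u + w) = 1 := by field_simp
  have hsum' : w / (u + w) + u / (u + w) = 1 := by rw [add_comm, hsum]
  have c1 := hg.concave.2 m1 m2 (div_pos hw huw).le (div_pos hu huw).le hsum'
  have c2 := hg.concave.2 m1 m2 (div_pos hu huw).le (div_pos hw huw).le hsum
  simp only [smul_eq_mul] at c1 c2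
  have r1 : w / (u + w) * v + u / (u + w) * (u + v + w) = u + v := by field_simp; ring
  have r2 : u / (u + w) * v + w / (u + w) * (u + v + w) = v + w := by field_simp; ring
  rw [r1] at c1
  rw [r2] at c2
  have : (u / (u + w) + w / (u + w)) * (g v + g (u + v + w)) = g v + g (u + v + w) := by
    rw [hsum, one_mul]
  nlinarith

/-! ### Noncrossing matchings of lists -/

/-- `NoncrossingWeight d l w`: some noncrossing perfect matching of the points listed in `l`, in
this order, has the weight `w` with respect to `d`. -/
inductive NoncrossingWeight (d : ℕ → ℕ → ℝ) : List ℕ → ℝ → Prop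
  | nil : NoncrossingWeight d [] 0
  | block {p q : ℕ} {l m : List ℕ} {v w : ℝ} (hl : NoncrossingWeight d l v)
      (hm : NoncrossingWeight d m w) :
      NoncrossingWeight d (p :: (l ++ q :: m)) (d p q + v + w)

/-- Adding an edge from a new first point to another new point to a noncrossing matching, and
uncrossing. -/
theorem NoncrossingWeight.exists_insert {s : Set ℕ} {d : ℕ → ℕ → ℝ} (hd : NestedLeCrossing s d)
    {l : List ℕ} {w : ℝ} (h : NoncrossingWeight d l w) :
    ∀ (l₁ l₂ : List ℕ) (z k : ℕ), l = l₁ ++ l₂ → (z :: (l₁ ++ k :: l₂)).Pairwise (· < ·) →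
      (∀ y ∈ z :: (l₁ ++ k :: l₂), y ∈ s) →
      ∃ w', w' ≤ d z k + w ∧ NoncrossingWeight d (z :: (l₁ ++ k :: l₂)) w' := by
  induction h with
  | nil =>
    intro l₁ l₂ z k hl _ _
    obtain ⟨rfl, rfl⟩ := List.append_eq_nil_iff.1 hl.symm
    exact ⟨d z k + 0 + 0, by linarith, .block .nil .nil⟩
  | @block p q m₁ m₂ v w h₁ h₂ ih₁ ih₂ =>
    intro l₁ l₂ z k hl hs hmem
    rcases l₁ with _ | ⟨p', l₁⟩
    · simp only [List.nil_append] at hl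
      subst hl
      exact ⟨d z k + 0 + (d p q + v + w), by linarith, .block .nil (.block h₁ h₂)⟩
    · simp only [List.cons_append, List.cons.injEq] at hl
      obtain ⟨rfl, hl⟩ := hl
      rcases List.append_eq_append_iff.1 hl with ⟨t, rfl, ht⟩ | ⟨t, rfl, ht⟩
      · -- `k` comes after the first block
        rcases t with _ | ⟨q', t⟩
        -- Empty `t` puts `k` just before `q`, hence inside the block: `z k` crosses `p q`. Both are
        -- replaced by `z q` and `p k`, and `p k` is inserted recursively.
        · simp only [List.nil_append] at ht
          subst ht
          simp only [List.append_nil] at *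
          obtain ⟨w', hw', hn⟩ := ih₁ m₁ [] p k (by simp)
            (by
              refine List.Pairwise.sublist ?_ hs
              simp)
            (by
              intro y hy
              apply hmem
              simp only [List.mem_cons, List.mem_append, List.not_mem_nil, or_false] at hy ⊢
              tauto)
          refine ⟨d z q + w' + w, ?_, ?_⟩
          · have := hd z (hmem _ (by simp)) p (hmem _ (by simp)) k (hmem _ (by simp)) q
              (hmem _ (by simp))
              (by simp only [List.pairwise_cons] at hs; exact hs.1 _ (by simp))
              (by simp only [List.cons_append, List.pairwise_cons] at hs
                  exact hs.2.1 _ (by simp))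
              (by simp only [List.cons_append, List.pairwise_cons, List.pairwise_append] at hs
                  exact hs.2.2.2.1.1 _ (by simp))
            linarith
          · have := NoncrossingWeight.block (p := z) (q := q) hn h₂
            simpa using this
        · simp only [List.cons_append, List.cons.injEq] at ht
          obtain ⟨rfl, rfl⟩ := ht
          obtain ⟨w', hw', hn⟩ := ih₂ t l₂ z k rfl
            (by
              refine List.Pairwise.sublist ?_ hs
              refine List.Sublist.cons_cons _ ?_
              simp only [List.cons_append, List.append_assoc]
              refine List.Sublist.cons _ ?_
              refine List.sublist_append_of_sublist_right ?_
              exact List.Sublist.cons _ (List.Sublist.refl _))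
            (by
              intro y hy
              apply hmem
              simp only [List.mem_cons, List.mem_append, List.cons_append] at hy ⊢
              tauto)
          -- The recursion inserted `z k` into the part after `q`. If `z` is now matched to `r`, the
          -- untouched block from `p` to `q` is nested under `z r`.
          generalize hL : z :: (t ++ k :: l₂) = L at hn
          cases hn with
          | nil => simp at hL
          | @block z' r n₁ n₂ v' w'' hn₁ hn₂ =>
            simp only [List.cons.injEq] at hL
            obtain ⟨rfl, hL⟩ := hL
            refine ⟨d z r + (d p q + v + v') + w'', by linarith, ?_⟩
            have := NoncrossingWeight.block (p := z) (q := r)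
              (NoncrossingWeight.block (p := p) (q := q) h₁ hn₁) hn₂
            simpa [hL] using this
      · -- `k` lies inside the first block
        subst ht
        obtain ⟨w', hw', hn⟩ := ih₁ l₁ t p k rfl
          (by
            refine List.Pairwise.sublist ?_ hs
            refine List.Sublist.cons _ ?_
            simp)
          (by
            intro y hy
            apply hmem
            simp only [List.mem_cons, List.mem_append, List.cons_append] at hy ⊢
            tauto)
        refine ⟨d z q + w' + w, ?_, ?_⟩
        · have := hd z (hmem _ (by simp)) p (hmem _ (by simp)) k (hmem _ (by simp)) q
            (hmem _ (by simp))
            (by simp only [List.pairwise_cons] at hs; exact hs.1 _ (by simp))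
            (by simp only [List.cons_append, List.pairwise_cons] at hs
                exact hs.2.1 _ (by simp))
            (by simp only [List.cons_append, List.pairwise_cons, List.pairwise_append] at hs
                exact hs.2.2.2.1.1 _ (by simp))
          linarith
        · have := NoncrossingWeight.block (p := z) (q := q) hn h₂
          simpa using this

theorem NoncrossingWeight.even_length {d : ℕ → ℕ → ℝ} {l : List ℕ} {w : ℝ}
    (h : NoncrossingWeight d l w) : Even l.length := by
  induction h with
  | nil => simp
  | block _ _ ih₁ ih₂ =>
    simp only [List.length_cons, List.length_append] at *
    grind

/-- Matching consecutive points suffices. This makes the set of matching weights nonempty, so that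
`sInf` in `W` is not a default value. -/
theorem exists_noncrossingWeight (d : ℕ → ℕ → ℝ) (m : ℕ) :
    ∀ l : List ℕ, l.length = 2 * m → ∃ w, NoncrossingWeight d l w := by
  induction m with
  | zero =>
    intro l hl
    obtain rfl : l = [] := by simpa using hl
    exact ⟨0, .nil⟩
  | succ m ih =>
    intro l hl
    match l, hl with
    | p :: q :: l, hl =>
      obtain ⟨w, hw⟩ := ih l (by simp only [List.length_cons] at hl; omega)
      exact ⟨_, NoncrossingWeight.block (p := p) (q := q) .nil hw⟩

/-! ### Noncrossing matchings and matchings of the complete graph -/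

theorem finite_edgeSet {M : (⊤ : SimpleGraph ℕ).Subgraph} (h : M.verts.Finite) :
    M.edgeSet.Finite := by
  refine ((h.prod h).image fun p => s(p.1, p.2)).subset ?_
  intro e he
  induction e with
  | _ a b =>
    have hab : M.Adj a b := he
    exact ⟨(a, b), ⟨hab.fst_mem, hab.snd_mem⟩, rfl⟩

theorem disjoint_edgeSet {M N : (⊤ : SimpleGraph ℕ).Subgraph} (h : Disjoint M.verts N.verts) :
    Disjoint M.edgeSet N.edgeSet := by
  rw [Set.disjoint_left] at *
  intro e he he'
  induction e with
  | _ a b =>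
    have h1 : M.Adj a b := he
    have h2 : N.Adj a b := he'
    exact h h1.fst_mem h2.fst_mem

theorem matchingWeight_sup (g : ℝ → ℝ) (x : ℕ → ℝ) {M N : (⊤ : SimpleGraph ℕ).Subgraph}
    (hM : M.verts.Finite) (hN : N.verts.Finite) (h : Disjoint M.verts N.verts) :
    matchingWeight g x (M ⊔ N) = matchingWeight g x M + matchingWeight g x N := by
  unfold matchingWeight
  rw [SimpleGraph.Subgraph.edgeSet_sup,
    finsum_mem_union (disjoint_edgeSet h) (finite_edgeSet hM) (finite_edgeSet hN)]

theorem isMatching_sup {M N : (⊤ : SimpleGraph ℕ).Subgraph} (hM : M.IsMatching)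
    (hN : N.IsMatching) (h : Disjoint M.verts N.verts) : (M ⊔ N).IsMatching :=
  hM.sup hN (by rwa [hM.support_eq_verts, hN.support_eq_verts])

theorem NoncrossingWeight.exists_matching {g : ℝ → ℝ} {x : ℕ → ℝ} {l : List ℕ} {w : ℝ}
    (h : NoncrossingWeight (fun a b => gaugeDist g (x a) (x b)) l w) (hl : l.Nodup) :
    ∃ M : (⊤ : SimpleGraph ℕ).Subgraph,
      M.verts = {y | y ∈ l} ∧ M.IsMatching ∧ matchingWeight g x M = w := by
  induction h with
  | nil => exact ⟨⊥, by simp, by intro v hv; simp at hv, by simp [matchingWeight]⟩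
  | @block p q l m v w _ _ ih₁ ih₂ =>
    simp only [List.nodup_cons, List.nodup_append, List.mem_append, List.mem_cons, not_or] at hl
    obtain ⟨⟨hp1, hpq, hp2⟩, hl1, ⟨hq, hm1⟩, hlm⟩ := hl
    obtain ⟨M, hMv, hM, hMw⟩ := ih₁ hl1
    obtain ⟨N, hNv, hN, hNw⟩ := ih₂ hm1
    have hMf : M.verts.Finite := by rw [hMv]; exact l.finite_toSet
    have hNf : N.verts.Finite := by rw [hNv]; exact m.finite_toSet
    have hadj : (⊤ : SimpleGraph ℕ).Adj p q := hpq
    have hMN : Disjoint M.verts N.verts := by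
      rw [hMv, hNv, Set.disjoint_left]
      exact fun y hy hy' => hlm y hy y (Or.inr hy') rfl
    have hE : Disjoint ((⊤ : SimpleGraph ℕ).subgraphOfAdj hadj).verts (M ⊔ N).verts := by
      rw [SimpleGraph.Subgraph.verts_sup, hMv, hNv, Set.disjoint_left]
      intro y hy hy'
      simp only [SimpleGraph.subgraphOfAdj_verts, Set.mem_insert_iff, Set.mem_singleton_iff] at hy
      rcases hy with rfl | rfl <;> rcases hy' with hy' | hy'
      · exact hp1 hy'
      · exact hp2 hy'
      · exact hlm _ hy' _ (Or.inl rfl) rfl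
      · exact hq hy'
    refine ⟨(⊤ : SimpleGraph ℕ).subgraphOfAdj hadj ⊔ (M ⊔ N), ?_, ?_, ?_⟩
    · ext y
      simp only [SimpleGraph.Subgraph.verts_sup, hMv, hNv, SimpleGraph.subgraphOfAdj_verts,
        Set.mem_union, Set.mem_insert_iff, Set.mem_singleton_iff, Set.mem_ofPred_eq,
        List.mem_cons, List.mem_append]
      tauto
    · exact isMatching_sup (SimpleGraph.Subgraph.IsMatching.subgraphOfAdj hadj)
        (isMatching_sup hM hN hMN) hE
    · rw [matchingWeight_sup g x (by simp) (by simpa using ⟨hMf, hNf⟩) hE,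
        matchingWeight_sup g x hMf hNf hMN, hMw, hNw, add_assoc]
      congr 1
      simp only [matchingWeight, SimpleGraph.edgeSet_subgraphOfAdj, finsum_mem_singleton]
      rfl

/-- Deleting an edge of a matching together with its end points. -/
theorem matching_delete_edge (g : ℝ → ℝ) (x : ℕ → ℝ) {M : (⊤ : SimpleGraph ℕ).Subgraph}
    (hM : M.IsMatching) (hf : M.verts.Finite) {z k : ℕ} (hzk : M.Adj z k) :
    (M.induce (M.verts \ {z, k})).IsMatching ∧
      matchingWeight g x M
        = gaugeDist g (x z) (x k) + matchingWeight g x (M.induce (M.verts \ {z, k})) := by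
  constructor
  · intro v hv
    obtain ⟨u, hu, hu'⟩ := hM hv.1
    refine ⟨u, ⟨hv, ⟨hu.snd_mem, ?_⟩, hu⟩, fun y hy => hu' y hy.2.2⟩
    rintro (rfl | rfl)
    · exact hv.2 (Or.inr (hM.eq_of_adj_left hu.symm hzk))
    · exact hv.2 (Or.inl (hM.eq_of_adj_right hu hzk))
  · have hE : M.edgeSet = insert s(z, k) (M.induce (M.verts \ {z, k})).edgeSet := by
      ext e
      induction e with
      | _ a b =>
        simp only [Set.mem_insert_iff, SimpleGraph.Subgraph.mem_edgeSet,
          SimpleGraph.Subgraph.induce_adj, Set.mem_sdiff, Set.mem_singleton_iff, not_or]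
        constructor
        · intro hab
          by_cases h : s(a, b) = s(z, k)
          · exact Or.inl h
          · right
            refine ⟨⟨hab.fst_mem, ?_, ?_⟩, ⟨hab.snd_mem, ?_, ?_⟩, hab⟩
            · rintro rfl
              exact h (by rw [hM.eq_of_adj_left hab hzk])
            · rintro rfl
              exact h (by rw [hM.eq_of_adj_left hab hzk.symm]; exact Sym2.eq_swap)
            · rintro rfl
              exact h (by rw [hM.eq_of_adj_left hab.symm hzk]; exact Sym2.eq_swap)
            · rintro rfl
              exact h (by rw [hM.eq_of_adj_left hab.symm hzk.symm])
        · rintro (h | h)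
          · have : s(a, b) ∈ M.edgeSet := by rw [h]; exact hzk
            exact this
          · exact h.2.2
    unfold matchingWeight
    rw [hE, finsum_mem_insert]
    · rfl
    · intro h
      have h' : (M.induce (M.verts \ {z, k})).Adj z k := h
      exact h'.1.2 (Or.inl rfl)
    · exact finite_edgeSet (by simpa using hf.subset Set.sdiff_subset)

/-- Every matching can be replaced by a noncrossing one that is at most as heavy. -/
theorem exists_noncrossingWeight_le {g : ℝ → ℝ} {x : ℕ → ℝ} {s : Set ℕ}
    (hd : NestedLeCrossing s (fun a b => gaugeDist g (x a) (x b))) (m : ℕ) :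
    ∀ (l : List ℕ), l.length ≤ m → l.Pairwise (· < ·) → (∀ y ∈ l, y ∈ s) →
      ∀ M : (⊤ : SimpleGraph ℕ).Subgraph, M.verts = {y | y ∈ l} → M.IsMatching →
        ∃ w ≤ matchingWeight g x M,
          NoncrossingWeight (fun a b => gaugeDist g (x a) (x b)) l w := by
  induction m with
  | zero =>
    intro l hl _ _ M hv hM
    obtain rfl : l = [] := by simpa using hl
    refine ⟨0, ?_, .nil⟩
    have : M.edgeSet = ∅ := by
      ext e
      induction e with
      | _ a b =>
        simp only [SimpleGraph.Subgraph.mem_edgeSet, Set.mem_empty_iff_false, iff_false]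
        intro hab
        have := hab.fst_mem
        simp [hv] at this
    simp [matchingWeight, this]
  | succ m ih =>
    intro l hl hs hmem M hv hM
    rcases l with _ | ⟨z, l⟩
    · exact ih [] (by simp) hs hmem M hv hM
    · have hf : M.verts.Finite := by rw [hv]; exact (z :: l).finite_toSet
      obtain ⟨k, hzk, -⟩ := hM (v := z) (by rw [hv]; simp)
      have hk : k ∈ l := by
        have h1 := hzk.snd_mem
        rw [hv] at h1
        rcases List.mem_cons.1 h1 with h1 | h1
        · exact absurd h1.symm hzk.ne
        · exact h1
      obtain ⟨l₁, l₂, rfl⟩ := List.append_of_mem hk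
      obtain ⟨hM', hw⟩ := matching_delete_edge g x hM hf hzk
      have hnd : (z :: (l₁ ++ k :: l₂)).Nodup := hs.imp (fun h => ne_of_lt h)
      -- The matching without `z` and its partner `k` is uncrossed by induction; `exists_insert`
      -- restores the edge.
      obtain ⟨w, hle, hn⟩ := ih (l₁ ++ l₂) (by simp at hl ⊢; omega)
        (hs.sublist (List.Sublist.cons _ (by simp)))
        (fun y hy => hmem y (by simp at hy ⊢; tauto)) _
        (by
          ext y
          simp only [SimpleGraph.Subgraph.induce_verts, hv, Set.mem_sdiff, Set.mem_ofPred_eq,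
            List.mem_cons, List.mem_append, Set.mem_insert_iff, Set.mem_singleton_iff]
          simp only [List.nodup_cons, List.nodup_append, List.mem_append, List.mem_cons,
            not_or] at hnd
          constructor
          · tauto
          · intro hy
            refine ⟨by tauto, ?_⟩
            rintro (rfl | rfl)
            · tauto
            · rcases hy with hy | hy
              · exact hnd.2.2.2 _ hy _ (Or.inl rfl) rfl
              · exact hnd.2.2.1.1 hy)
        hM'
      obtain ⟨w', hw', hn'⟩ := hn.exists_insert hd l₁ l₂ z k rfl hs hmem
      exact ⟨w', by linarith, hn'⟩

/-! ### The minimum weights on intervals -/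

/-- `V a b` behaves like the minimum weight of a noncrossing perfect matching on the points
`a, …, b - 1`, for all `1 ≤ a ≤ b ≤ N` of equal parity: it is the minimum over the possible
partners `q` of the first point `a`. -/
structure IsBlockMinimum (N : ℕ) (d V : ℕ → ℕ → ℝ) : Prop where
  self : ∀ a, 1 ≤ a → V a a = 0
  le : ∀ a q b, 1 ≤ a → a < q → q < b → b ≤ N → Odd (a + q) → Even (a + b) →
    V a b ≤ d a q + V (a + 1) q + V (q + 1) b
  exists_eq : ∀ a b, 1 ≤ a → a < b → b ≤ N → Even (a + b) →
    ∃ q, a < q ∧ q < b ∧ Odd (a + q) ∧ V a b = d a q + V (a + 1) q + V (q + 1) b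

/-- The quadrangle inequality for minimum weights on intervals. -/
theorem IsBlockMinimum.quadrangle {N : ℕ} {d V : ℕ → ℕ → ℝ} (hV : IsBlockMinimum N d V)
    (hd : NestedLeCrossing (Set.Ico 1 N) d) (m : ℕ) :
    ∀ a a' b' b : ℕ, (b - a) + (b' - a') ≤ m → 1 ≤ a → a ≤ a' → a' ≤ b' → b' ≤ b → b ≤ N →
      Even (a + b) → Even (a' + b) → Even (b' + b) →
      V a b + V a' b' ≤ V a b' + V a' b := by
  induction m with
  | zero =>
    intro a a' b' b hm h1 h2 h3 h4 _ _ _ _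
    obtain rfl : a = b := by omega
    obtain rfl : a = a' := by omega
    obtain rfl : a = b' := by omega
    exact le_refl _
  | succ m ih =>
    intro a a' b' b hm h1 h2 h3 h4 h5 p1 p2 p3
    rcases eq_or_lt_of_le h2 with rfl | h2'
    · linarith
    rcases eq_or_lt_of_le h4 with rfl | h4'
    · linarith
    -- `q` and `r` are the partners of `a` and `a'` in optimal matchings for `V a b'` and `V a' b`.
    -- If `q < a'`, the block from `a` to `q` is split off.
    obtain ⟨q, hq1, hq2, hq3, hq⟩ := hV.exists_eq a b' h1 (by omega) (by omega) (by grind)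
    by_cases hqa : q + 1 ≤ a'
    · have i1 := ih (q + 1) a' b' b (by omega) (by omega) hqa h3 h4 h5 (by grind) p2 p3
      have i2 := hV.le a q b h1 hq1 (by omega) h5 hq3 p1
      linarith
    obtain ⟨r, hr1, hr2, hr3, hr⟩ := hV.exists_eq a' b (by omega) (by omega) (by omega) p2
    have hqa' : a' < q := by
      rcases eq_or_lt_of_le (show a' ≤ q by omega) with h | h
      · grind
      · exact h
    -- For `r ≤ q` the block from `a'` to `r` is moved over to `V a' b'`. Otherwise `a < a' < q <
    -- r`: the edges `a q` and `a' r` cross and become `a r` and `a' q`, while induction exchanges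
    -- the two interiors.
    by_cases hrq : r ≤ q
    · have i1 := ih a (r + 1) b' b (by omega) h1 (by omega) (by omega) h4 h5 p1 (by grind) p3
      have i2 := hV.le a' r b' (by omega) hr1 (by omega) (by omega) hr3 (by grind)
      linarith
    · have i1 := ih (a + 1) (a' + 1) q r (by omega) (by omega) (by omega) (by omega) (by omega)
        (by omega) (by grind) (by grind) (by grind)
      have i2 := hV.le a r b h1 (by omega) (by omega) h5 (by grind) p1
      have i3 := hV.le a' q b' (by omega) hqa' hq2 (by omega) (by grind) (by grind)
      have i4 := hd a ⟨h1, by omega⟩ a' ⟨by omega, by omega⟩ q ⟨by omega, by omega⟩ r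
        ⟨by omega, by omega⟩ h2' hqa' (by omega)
      linarith

/-- The recursion for minimum weights on intervals of at least four points. -/
theorem IsBlockMinimum.recursion {N : ℕ} {d V : ℕ → ℕ → ℝ} (hV : IsBlockMinimum N d V)
    (hd : NestedLeCrossing (Set.Ico 1 N) d) {a j : ℕ} (h1 : 1 ≤ a) (h2 : a + 3 ≤ j)
    (h3 : j + 1 ≤ N) (hp : Odd (a + j)) :
    V a (j + 1) = min (d a j + V (a + 1) j)
      (V a (j - 1) + V (a + 2) (j + 1) - V (a + 2) (j - 1)) := by
  have hQ := fun a a' b' b => hV.quadrangle hd _ a a' b' b le_rfl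
  have s1 := hV.le a j (j + 1) h1 (by omega) (by omega) h3 hp (by grind)
  have s2 := hQ a (a + 2) (j - 1) (j + 1) h1 (by omega) (by omega) (by omega) h3 (by grind)
    (by grind) (by grind)
  rw [hV.self (j + 1) (by omega)] at s1
  apply le_antisymm
  · exact le_min (by linarith) (by linarith)
  · obtain ⟨q, hq1, hq2, hq3, hq⟩ := hV.exists_eq a (j + 1) h1 (by omega) h3 (by grind)
    rcases eq_or_lt_of_le (show q ≤ j by omega) with rfl | hqj
    · rw [hV.self (q + 1) (by omega)] at hq
      exact (min_le_left _ _).trans (by linarith)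
    -- With `c = q + 1`, the bound follows by adding `hq`, `t1`, `t3` and `t4`; the last is
    -- subadditivity at `c`, the quadrangle inequality with an empty inner interval.
    · refine (min_le_right _ _).trans ?_
      have hqj' : q + 1 ≤ j - 1 := by grind
      have hqa : a + 2 ≤ q + 1 := by omega
      have t1 := hV.le a q (q + 1) h1 hq1 (by omega) (by omega) hq3 (by grind)
      rw [hV.self (q + 1) (by omega)] at t1
      have t2 := hQ a (a + 2) (q + 1) (j + 1) h1 (by omega) hqa (by omega) h3 (by grind)
        (by grind) (by grind)
      have t3 := hQ (a + 2) (q + 1) (j - 1) (j + 1) (by omega) hqa hqj' (by omega) h3 (by grind)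
        (by grind) (by grind)
      have t4 := hQ a (q + 1) (q + 1) (j - 1) h1 (by omega) le_rfl hqj' (by omega) (by grind)
        (by grind) (by grind)
      have t5 := hQ (a + 2) (q + 1) (q + 1) (j + 1) (by omega) hqa le_rfl (by omega) h3
        (by grind) (by grind) (by grind)
      rw [hV.self (q + 1) (by omega)] at t4 t5
      linarith

/-! ### The numbers `W` -/

theorem W_pred (g : ℝ → ℝ) (x : ℕ → ℝ) {i : ℕ} (hi : 1 ≤ i) : W g x i (i - 1) = 0 := by
  unfold W
  rw [if_pos (by omega)]

theorem W_add_two_pred (g : ℝ → ℝ) (x : ℕ → ℝ) {i : ℕ} (hi : 1 ≤ i) :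
    W g x (i + 2) (i - 1) = -gaugeDist g (x i) (x (i + 1)) := by
  unfold W
  rw [if_neg (by omega), if_pos (by omega), show i - 1 + 1 = i by omega,
    show i - 1 + 2 = i + 1 by omega]

theorem finite_matchingWeights (g : ℝ → ℝ) (x : ℕ → ℝ) (i j : ℕ) :
    (matchingWeights g x i j).Finite := by
  have h : ((fun p : ℕ × ℕ => s(p.1, p.2)) '' (Set.Icc i j ×ˢ Set.Icc i j)).Finite :=
    ((Set.finite_Icc i j).prod (Set.finite_Icc i j)).image _
  refine (h.finite_subsets.image fun E => ∑ᶠ e ∈ E, edgeWeight g x e).subset ?_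
  rintro w ⟨M, ⟨hv, -⟩, rfl⟩
  refine ⟨M.edgeSet, ?_, rfl⟩
  intro e he
  induction e with
  | _ a b =>
    have hab : M.Adj a b := he
    exact ⟨(a, b), ⟨hv ▸ hab.fst_mem, hv ▸ hab.snd_mem⟩, rfl⟩

/-- The minimum weight of a perfect matching on an interval is attained, and it is the minimum
weight of a noncrossing perfect matching. -/
theorem W_isLeast {g : ℝ → ℝ} {x : ℕ → ℝ} {i j : ℕ}
    (hd : NestedLeCrossing (Set.Icc i j) (fun a b => gaugeDist g (x a) (x b)))
    (hij : i ≤ j + 1) (hp : Odd (i + j)) :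
    IsLeast {w | NoncrossingWeight (fun a b => gaugeDist g (x a) (x b))
      (List.range' i (j + 1 - i)) w} (W g x i j) ∧
    (i < j → IsLeast (matchingWeights g x i j) (W g x i j)) := by
  have hmem : ∀ y, y ∈ List.range' i (j + 1 - i) ↔ y ∈ Set.Icc i j := by
    intro y
    rw [List.mem_range'_1, Set.mem_Icc]
    omega
  rcases eq_or_lt_of_le hij with rfl | hij
  · constructor
    · rw [show W g x (j + 1) j = 0 from W_pred g x (i := j + 1) (by omega)]
      simp only [Nat.sub_self, List.range'_zero]
      refine ⟨.nil, ?_⟩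
      intro w hw
      cases hw
      exact le_rfl
    · intro h
      omega
  · have hij' : i < j := by grind
    have hto : ∀ w, NoncrossingWeight (fun a b => gaugeDist g (x a) (x b))
        (List.range' i (j + 1 - i)) w → w ∈ matchingWeights g x i j := by
      intro w hw
      obtain ⟨M, hMv, hM, hMw⟩ := hw.exists_matching List.nodup_range'
      refine ⟨M, ⟨?_, hM⟩, hMw.symm⟩
      rw [hMv]
      ext y
      exact hmem y
    have hfrom : ∀ w ∈ matchingWeights g x i j, ∃ w' ≤ w,
        NoncrossingWeight (fun a b => gaugeDist g (x a) (x b))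
          (List.range' i (j + 1 - i)) w' := by
      rintro w ⟨M, ⟨hMv, hM⟩, rfl⟩
      refine exists_noncrossingWeight_le hd _ _ le_rfl List.pairwise_lt_range'
        (fun y hy => (hmem y).1 hy) M ?_ hM
      rw [hMv]
      ext y
      exact (hmem y).symm
    have hne : (matchingWeights g x i j).Nonempty := by
      obtain ⟨w, hw⟩ := exists_noncrossingWeight (fun a b => gaugeDist g (x a) (x b))
        ((j + 1 - i) / 2) (List.range' i (j + 1 - i)) (by rw [List.length_range']; grind)
      exact ⟨w, hto w hw⟩
    have hW : IsLeast (matchingWeights g x i j) (W g x i j) := by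
      unfold W
      rw [if_neg (by omega), if_neg (by omega)]
      exact ⟨hne.csInf_mem (finite_matchingWeights g x i j),
        fun w hw => csInf_le (finite_matchingWeights g x i j).bddBelow hw⟩
    refine ⟨⟨?_, fun w hw => hW.2 (hto w hw)⟩, fun _ => hW⟩
    obtain ⟨w, hw, hn⟩ := hfrom _ hW.1
    have : W g x i j = w := le_antisymm (hW.2 (hto w hn)) hw
    rw [this]
    exact hn

theorem range'_eq_block {a q b : ℕ} (haq : a < q) (hqb : q < b) :
    List.range' a (b - a) =
      a :: (List.range' (a + 1) (q - (a + 1)) ++ q :: List.range' (q + 1) (b - (q + 1))) := by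
  rw [List.range'_eq_cons_iff]
  refine ⟨rfl, by omega, ?_⟩
  rw [eq_comm, List.range'_eq_append_iff]
  refine ⟨q - (a + 1), by omega, rfl, ?_⟩
  symm
  rw [List.range'_eq_cons_iff]
  refine ⟨by omega, by omega, ?_⟩
  congr 1
  omega

/-- The half-open form turns the convention `W i (i - 1) = 0` into the value of the empty interval,
so a block with empty interior or empty remainder needs no separate case. -/
theorem W_isBlockMinimum {g : ℝ → ℝ} {x : ℕ → ℝ} {N : ℕ}
    (hd : NestedLeCrossing (Set.Ico 1 N) (fun a b => gaugeDist g (x a) (x b))) :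
    IsBlockMinimum N (fun a b => gaugeDist g (x a) (x b)) (fun a b => W g x a (b - 1)) := by
  have key : ∀ a b, 1 ≤ a → a ≤ b → b ≤ N → Even (a + b) →
      IsLeast {w | NoncrossingWeight (fun a b => gaugeDist g (x a) (x b))
        (List.range' a (b - a)) w} (W g x a (b - 1)) := by
    intro a b h1 h2 h3 hp
    have := (W_isLeast (g := g) (x := x) (i := a) (j := b - 1)
      (fun a' ha' b' hb' c' hc' e' he' => by
        simp only [Set.mem_Icc] at ha' hb' hc' he'
        exact hd a' ⟨by omega, by omega⟩ b' ⟨by omega, by omega⟩ c' ⟨by omega, by omega⟩ e'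
          ⟨by omega, by omega⟩)
      (by omega) (by grind)).1
    rwa [show b - 1 + 1 = b by omega] at this
  refine ⟨fun a ha => W_pred g x ha, ?_, ?_⟩
  · intro a q b h1 h2 h3 h4 hp hp'
    apply (key a b h1 (by omega) h4 hp').2
    rw [range'_eq_block h2 h3]
    exact .block (key (a + 1) q (by omega) (by omega) (by omega) (by grind)).1
      (key (q + 1) b (by omega) (by omega) h4 (by grind)).1
  · intro a b h1 h2 h3 hp
    have h := (key a b h1 h2.le h3 hp).1
    simp only [Set.mem_ofPred_eq] at h
    generalize hw : W g x a (b - 1) = w at h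
    generalize hL : List.range' a (b - a) = L at h
    cases h with
    | nil =>
      have := congrArg List.length hL
      simp at this
      omega
    | @block p q l m v w hl hm =>
      have hmem : q ∈ List.range' a (b - a) := by rw [hL]; simp
      have hsort : (List.range' a (b - a)).Pairwise (· < ·) := List.pairwise_lt_range'
      rw [List.mem_range'_1] at hmem
      rw [List.range'_eq_cons_iff] at hL
      obtain ⟨rfl, -, hL⟩ := hL
      rw [eq_comm, List.range'_eq_append_iff] at hL
      obtain ⟨k, hk, rfl, hL⟩ := hL
      rw [eq_comm, List.range'_eq_cons_iff] at hL
      obtain ⟨hq, hk', rfl⟩ := hL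
      -- The points between `a` and `q` are matched among themselves, which fixes the parity of `q`.
      have hev := hl.even_length
      rw [List.length_range'] at hev
      have hpq : Odd (a + q) := by grind
      refine ⟨q, by omega, by omega, hpq, ?_⟩
      have i1 := (key (a + 1) q (by omega) (by omega) (by omega) (by grind)).2
        (show v ∈ _ by
          rw [Set.mem_ofPred_eq, show q - (a + 1) = k by omega]
          exact hl)
      have i2 := (key (q + 1) b (by omega) (by omega) (by omega) (by grind)).2
        (show w ∈ _ by
          rw [Set.mem_ofPred_eq, show b - (q + 1) = b - a - 1 - k - 1 by omega]
          exact hm)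
      have i3 := (key a b h1 h2.le h3 hp).2
        (show gaugeDist g (x a) (x q) + W g x (a + 1) (q - 1) + W g x (q + 1) (b - 1) ∈ _ by
          rw [Set.mem_ofPred_eq, range'_eq_block (show a < q by omega) (show q < b by omega)]
          exact .block (key (a + 1) q (by omega) (by omega) (by omega) (by grind)).1
            (key (q + 1) b (by omega) (by omega) h3 (by grind)).1)
      -- The two parts weigh at least their minima, and recombining these minima cannot beat the
      -- optimum.
      linarith

/-- The recursion for the numbers `W`. -/
theorem W_recursion {g : ℝ → ℝ} (hg : IsConcaveGauge g) {N : ℕ} {x : ℕ → ℝ}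
    (hx : StrictMonoOn x (Set.Icc 1 N)) {i j : ℕ} (hi : 1 ≤ i) (hij : i < j) (hj : j ≤ N)
    (hp : Odd (i + j)) :
    W g x i j = min (gaugeDist g (x i) (x j) + W g x (i + 1) (j - 1))
      (W g x i (j - 2) + W g x (i + 2) j - W g x (i + 2) (j - 2)) := by
  have hI : Set.Ico 1 (N + 1) = Set.Icc 1 N := by
    ext y
    simp only [Set.mem_Ico, Set.mem_Icc]
    omega
  have hd : NestedLeCrossing (Set.Ico 1 (N + 1)) (fun a b => gaugeDist g (x a) (x b)) :=
    hg.nestedLeCrossing (by rwa [hI])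
  have hV := W_isBlockMinimum hd
  rcases eq_or_lt_of_le (show i + 1 ≤ j by omega) with rfl | hij'
  -- For two points the convention `W (i + 2) (i - 1) = -d` makes both terms of the minimum equal to
  -- `d`, the distance of the two points.
  · obtain ⟨q, h1, h2, -, h⟩ := hV.exists_eq i (i + 2) hi (by omega) (by omega) (by grind)
    obtain rfl : q = i + 1 := by omega
    have e1 : W g x (i + 1) i = 0 := W_pred g x (i := i + 1) (by omega)
    have e2 : W g x (i + 2) (i + 1) = 0 := W_pred g x (i := i + 2) (by omega)
    have e3 := W_pred g x hi
    have e4 := W_add_two_pred g x hi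
    simp only [show i + 2 - 1 = i + 1 by omega, show i + 1 - 1 = i by omega,
      show i + 1 - 2 = i - 1 by omega, show i + 1 + 1 = i + 2 by omega] at h ⊢
    rw [e1, e2] at h
    rw [e1, e2, e3, e4, h]
    simp
  · exact hV.recursion hd (a := i) (j := j) hi (by grind) (by omega) hp

/-! ### The bottom-up program -/

theorem upTo_induction {σ : Type} (P : ℕ → σ → Prop) {r : ℕ} {f : ℕ → σ → σ} {s : σ}
    (h0 : P 0 s) (hstep : ∀ k t, k < r → P k t → P (k + 1) (f (k + 1) t)) :
    P r (upTo r f s) := by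
  induction r with
  | zero => exact h0
  | succ r ih => exact hstep r _ (by omega) (ih fun k t hk => hstep k t (by omega))

/-- Invariant rule for loops: the table satisfies `P k` after `k` rounds, each of which takes at
most `c` operations. -/
theorem exec_loop {n : ℕ} {D : ℕ → ℕ → ℝ} {v : ℕ} {bound : IndexExpr} {body : Program}
    {env : ℕ → ℕ} {mem : ℕ → ℕ → ℝ} (P : ℕ → (ℕ → ℕ → ℝ) → Prop) (c : ℕ) (h0 : P 0 mem)
    (hstep : ∀ k t, k < bound.eval n env → P k t →
      P (k + 1) (body.exec n D (Function.update env v (k + 1)) t).1 ∧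
        (body.exec n D (Function.update env v (k + 1)) t).2 ≤ c) :
    P (bound.eval n env) ((Program.loop v bound body).exec n D env mem).1 ∧
      ((Program.loop v bound body).exec n D env mem).2
        ≤ bound.cost + 1 + bound.eval n env * (c + 1) := by
  simp only [Program.exec]
  refine upTo_induction (fun k (st : (ℕ → ℕ → ℝ) × ℕ) =>
    P k st.1 ∧ st.2 ≤ bound.cost + 1 + k * (c + 1)) ⟨h0, by simp⟩ ?_
  rintro k t hk ⟨h1, h2⟩
  obtain ⟨h3, h4⟩ := hstep k t.1 hk h1
  refine ⟨h3, ?_⟩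
  simp only
  rw [Nat.succ_mul]
  omega

theorem exec_initZero (n : ℕ) (D : ℕ → ℕ → ℝ) (env : ℕ → ℕ) (mem : ℕ → ℕ → ℝ) :
    (∀ i, 1 ≤ i → i ≤ 2 * n + 1 → (initZero.exec n D env mem).1 i (i - 1) = 0) ∧
      (initZero.exec n D env mem).2 ≤ 14 * n + 13 := by
  have h := exec_loop (n := n) (D := D) (v := 0) (bound := .add (.add .size .size) (.lit 1))
    (body := .store iVar (.sub iVar (.lit 1)) .zero) (env := env) (mem := mem)
    (fun k t => ∀ i, 1 ≤ i → i ≤ k → t i (i - 1) = 0) 6 (fun i h1 h2 => by omega)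
    (by
      intro k t _ ht
      refine ⟨?_, by simp [Program.exec, iVar, IndexExpr.cost, RealExpr.cost]⟩
      intro i h1 h2
      simp only [Program.exec, iVar, IndexExpr.eval, RealExpr.eval, Function.update_self]
      split_ifs with hi
      · rfl
      · exact ht i h1 (by omega))
  simp only [IndexExpr.eval, IndexExpr.cost] at h
  exact ⟨fun i h1 h2 => h.1 i h1 (by omega), h.2.trans (by omega)⟩

theorem exec_initNeg (n : ℕ) (D : ℕ → ℕ → ℝ) (env : ℕ → ℕ) (mem : ℕ → ℕ → ℝ)
    (hmem : ∀ i, 1 ≤ i → i ≤ 2 * n + 1 → mem i (i - 1) = 0) :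
    (∀ i, 1 ≤ i → i ≤ 2 * n + 1 → (initNeg.exec n D env mem).1 i (i - 1) = 0) ∧
      (∀ i, 1 ≤ i → i ≤ 2 * n - 1 →
        (initNeg.exec n D env mem).1 (i + 2) (i - 1) = -D i (i + 1)) ∧
      (initNeg.exec n D env mem).2 ≤ 28 * n + 6 := by
  have h := exec_loop (n := n) (D := D) (v := 0) (bound := .sub (.add .size .size) (.lit 1))
    (body := .store (.add iVar (.lit 2)) (.sub iVar (.lit 1))
      (.neg (.dist iVar (.add iVar (.lit 1))))) (env := env) (mem := mem)
    (fun k t => (∀ i, 1 ≤ i → i ≤ 2 * n + 1 → t i (i - 1) = 0) ∧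
      ∀ i, 1 ≤ i → i ≤ k → t (i + 2) (i - 1) = -D i (i + 1)) 13
    ⟨hmem, fun i h1 h2 => by omega⟩
    (by
      rintro k t _ ⟨ht, ht'⟩
      refine ⟨⟨?_, ?_⟩, by simp [Program.exec, iVar, IndexExpr.cost, RealExpr.cost]⟩
      · intro i h1 h2
        simp only [Program.exec, iVar, IndexExpr.eval, RealExpr.eval, Function.update_self]
        -- The entries `(i + 2, i - 1)` lie off the diagonal of zeros, which therefore survives.
        rw [if_neg (by omega)]
        exact ht i h1 h2
      · intro i h1 h2
        simp only [Program.exec, iVar, IndexExpr.eval, RealExpr.eval, Function.update_self]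
        split_ifs with hi
        · obtain rfl : i = k + 1 := by omega
          rfl
        · exact ht' i h1 (by omega))
  simp only [IndexExpr.eval, IndexExpr.cost] at h
  exact ⟨h.1.1, fun i h1 h2 => h.1.2 i h1 (by omega), h.2.trans (by omega)⟩

/-- The entries of the table that are present after `s` rows of the pyramid. -/
def IsPyramidEntry (n s i j : ℕ) : Prop :=
  1 ≤ i ∧ i ≤ 2 * n + 1 ∧ j ≤ 2 * n ∧ Odd (i + j) ∧ i ≤ j + 3 ∧ j + 1 ≤ i + 2 * s

/-- The program fills the table with any function `T` that satisfies the initial conditions and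
the recursion. -/
theorem exec_bottomUp {n : ℕ} {D T : ℕ → ℕ → ℝ} (hn : 1 ≤ n)
    (h0 : ∀ i, 1 ≤ i → T i (i - 1) = 0)
    (h1 : ∀ i, 1 ≤ i → T (i + 2) (i - 1) = -D i (i + 1))
    (hT : ∀ i j, 1 ≤ i → i < j → j ≤ 2 * n → Odd (i + j) →
      T i j = min (D i j + T (i + 1) (j - 1)) (T i (j - 2) + T (i + 2) j - T (i + 2) (j - 2)))
    (env : ℕ → ℕ) (mem : ℕ → ℕ → ℝ) :
    (∀ i j, 1 ≤ i → i < j → j ≤ 2 * n → Odd (i + j) → (bottomUp.exec n D env mem).1 i j = T i j) ∧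
      (bottomUp.exec n D env mem).2 ≤ 300 * n ^ 2 := by
  set mem₁ := (initZero.exec n D env mem).1
  set mem₂ := (initNeg.exec n D env mem₁).1
  obtain ⟨z1, z2⟩ := exec_initZero n D env mem
  obtain ⟨y1, y2, y3⟩ := exec_initNeg n D env mem₁ z1
  have hcost : ∀ env' mem', (updateEntry.exec n D env' mem').2 ≤ 80 := by
    intro env' mem'
    simp [updateEntry, Program.exec, iVar, jExpr, sVar, IndexExpr.cost, RealExpr.cost]
  -- A row costs 9 for its bound, 1 for the set-up, and at most `80 + 1` for each of at most `2 * n`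
  -- entries.
  have houter := exec_loop (n := n) (D := D) (v := 1) (bound := .size)
    (body := .loop 0 (.add (.sub (.add .size .size) (.add sVar sVar)) (.lit 1)) updateEntry)
    (env := env) (mem := mem₂)
    (fun s t => ∀ i j, IsPyramidEntry n s i j → t i j = T i j) (10 + 2 * n * 81)
    (by
      rintro i j ⟨i1, i2, i3, i4, i5, i6⟩
      -- For `s = 0` the bounds and parity leave just the two diagonals of initial values.
      have hij : i = j + 1 ∨ i = j + 3 := by grind
      rcases hij with rfl | rfl
      · have e1 := h0 (j + 1) (by omega)
        have e2 := y1 (j + 1) (by omega) i2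
        rw [Nat.add_sub_cancel] at e1 e2
        rw [e1]
        exact e2
      · have e1 := h1 (j + 1) (by omega)
        have e2 := y2 (j + 1) (by omega) (by omega)
        rw [Nat.add_sub_cancel] at e1 e2
        rw [show j + 3 = j + 1 + 2 by omega, e1]
        exact e2)
    (by
      intro s t hs ht
      simp only [IndexExpr.eval] at hs
      have hinner := exec_loop (n := n) (D := D) (v := 0)
        (bound := .add (.sub (.add .size .size) (.add sVar sVar)) (.lit 1)) (body := updateEntry)
        (env := Function.update env 1 (s + 1)) (mem := t)
        (fun k t => (∀ i j, IsPyramidEntry n s i j → t i j = T i j) ∧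
          ∀ i j, IsPyramidEntry n (s + 1) i j → i ≤ k → t i j = T i j) 80
        ⟨ht, fun i j h hi => by have := h.1; omega⟩
        (by
          rintro k u hk ⟨hu, hu'⟩
          simp only [IndexExpr.eval, sVar, Function.update_self] at hk
          refine ⟨?_, hcost _ _⟩
          have hval : ∀ i j, (updateEntry.exec n D
              (Function.update (Function.update env 1 (s + 1)) 0 (k + 1)) u).1 i j
              = if i = k + 1 ∧ j = k + 1 + (s + 1 + (s + 1)) - 1
                then T (k + 1) (k + 1 + (s + 1 + (s + 1)) - 1) else u i j := by
            intro i j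
            simp only [updateEntry, Program.exec, iVar, jExpr, sVar, IndexExpr.eval,
              RealExpr.eval, Function.update_self, ne_eq, one_ne_zero, not_false_eq_true,
              Function.update_of_ne]
            split_ifs
            -- All four entries read belong to earlier rows or the initial diagonals, where `hu`
            -- applies.
            · rw [hT (k + 1) _ (by omega) (by omega) (by omega) (by grind),
                hu _ _ ⟨by omega, by omega, by omega, by grind, by omega, by omega⟩,
                hu _ _ ⟨by omega, by omega, by omega, by grind, by omega, by omega⟩,
                hu _ _ ⟨by omega, by omega, by omega, by grind, by omega, by omega⟩,
                hu _ _ ⟨by omega, by omega, by omega, by grind, by omega, by omega⟩]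
            · rfl
          constructor
          · intro i j h
            rw [hval]
            split_ifs with hc
            · rw [hc.1, hc.2]
            · exact hu i j h
          · intro i j h hi
            rw [hval]
            split_ifs with hc
            · rw [hc.1, hc.2]
            · by_cases h' : IsPyramidEntry n s i j
              · exact hu i j h'
              · refine hu' i j h ?_
                obtain ⟨i1, i2, i3, i4, i5, i6⟩ := h
                have : ¬ j + 1 ≤ i + 2 * s := fun h7 => h' ⟨i1, i2, i3, i4, i5, h7⟩
                grind)
      simp only [IndexExpr.eval, IndexExpr.cost, sVar, Function.update_self] at hinner
      refine ⟨?_, hinner.2.trans ?_⟩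
      · intro i j h
        by_cases h' : IsPyramidEntry n s i j
        · exact hinner.1.1 i j h'
        · refine hinner.1.2 i j h ?_
          obtain ⟨i1, i2, i3, i4, i5, i6⟩ := h
          have : ¬ j + 1 ≤ i + 2 * s := fun h7 => h' ⟨i1, i2, i3, i4, i5, h7⟩
          grind
      · have : (n + n - (s + 1 + (s + 1)) + 1) * 81 ≤ 2 * n * 81 :=
          Nat.mul_le_mul_right _ (by omega)
        omega)
  simp only [IndexExpr.eval, IndexExpr.cost] at houter
  refine ⟨?_, ?_⟩
  · intro i j i1 i2 i3 i4
    exact houter.1 i j ⟨i1, by omega, i3, i4, by omega, by omega⟩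
  · have e : (bottomUp.exec n D env mem).2 = (initZero.exec n D env mem).2 +
        ((initNeg.exec n D env mem₁).2 +
          ((Program.loop 1 .size (.loop 0 (.add (.sub (.add .size .size) (.add sVar sVar))
            (.lit 1)) updateEntry)).exec n D env mem₂).2) := rfl
    rw [e]
    have := houter.2
    -- The total is at most `162 * n ^ 2 + 53 * n + 21`, which is below `300 * n ^ 2` since `n ≥ 1`.
    nlinarith

end LineMatching

/-- Recursion for the minimum weights of partial perfect matchings, with its initial conditions,
and computation of all these weights by the bottom-up program in `O(n ^ 2)` operations. -/
theorem theorem3 :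
    (∀ (g : ℝ → ℝ), LineMatching.IsConcaveGauge g →
      ∀ (n : ℕ) (x : ℕ → ℝ), StrictMonoOn x (Set.Icc 1 (2 * n)) →
        (∀ i j : ℕ, 1 ≤ i → i < j → j ≤ 2 * n → Odd (i + j) →
          IsLeast (LineMatching.matchingWeights g x i j) (LineMatching.W g x i j) ∧
          LineMatching.W g x i j =
            min (LineMatching.gaugeDist g (x i) (x j) + LineMatching.W g x (i + 1) (j - 1))
              (LineMatching.W g x i (j - 2) + LineMatching.W g x (i + 2) j
                - LineMatching.W g x (i + 2) (j - 2))) ∧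
        (∀ i : ℕ, 1 ≤ i → LineMatching.W g x i (i - 1) = 0) ∧
        (∀ i : ℕ, 1 ≤ i →
          LineMatching.W g x (i + 2) (i - 1) = -LineMatching.gaugeDist g (x i) (x (i + 1)))) ∧
    (∃ C : ℕ, ∀ (g : ℝ → ℝ), LineMatching.IsConcaveGauge g →
      ∀ (n : ℕ) (x : ℕ → ℝ), 1 ≤ n → StrictMonoOn x (Set.Icc 1 (2 * n)) →
        ∀ (env : ℕ → ℕ) (mem : ℕ → ℕ → ℝ),
          (∀ i j : ℕ, 1 ≤ i → i < j → j ≤ 2 * n → Odd (i + j) →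
            (LineMatching.bottomUp.exec n
              (fun a b => LineMatching.gaugeDist g (x a) (x b)) env mem).1 i j
              = LineMatching.W g x i j) ∧
          (LineMatching.bottomUp.exec n
            (fun a b => LineMatching.gaugeDist g (x a) (x b)) env mem).2 ≤ C * n ^ 2) := by
  refine ⟨fun g hg n x hx => ⟨fun i j hi hij hj hp => ⟨?_, ?_⟩, fun i hi => ?_, fun i hi => ?_⟩,
    300, fun g hg n x hn hx env mem => ?_⟩
  · refine (LineMatching.W_isLeast (hg.nestedLeCrossing (hx.mono ?_)) (by omega) hp).2 hij
    exact Set.Icc_subset_Icc hi hj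
  · exact LineMatching.W_recursion hg hx hi hij hj hp
  · exact LineMatching.W_pred g x hi
  · exact LineMatching.W_add_two_pred g x hi
  · exact LineMatching.exec_bottomUp hn (fun i hi => LineMatching.W_pred g x hi)
      (fun i hi => LineMatching.W_add_two_pred g x hi)
      (fun i j hi hij hj hp => LineMatching.W_recursion hg hx hi hij hj hp) env mem
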